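/- A non-symmetric operad (multicategory) $P$ has a set of objects, sets of morphisms $P(p_1,\dots,p_n;p_0)$ for all $n\ge 0$ and all objects $p_0,\dots,p_n$, identities in $P(p;p)$, and an associative and unital composition $\psi\circ(\psi_1,\dots,\psi_n)$. A symmetric operad has in addition maps $\sigma^*:P(p_1,\dots,p_n;p_0)\to P(p_{\sigma(1)},\dots,p_{\sigma(n)};p_0)$, $\sigma\in\Sigma_n$, which form an action and are compatible with composition. Let $\mathbf{Ope}$ and $\mathbf{Ope}_\Sigma$ be the categories of small non-symmetric and of small symmetric operads, with the structure-preserving maps (functors) as morphisms. Let $j^*P$ be the underlying category of an operad $P$, formed by its unary morphisms; isomorphisms in $P$ are those of $j^*P$. Let $\star$ be the operad with one object and only one morphism, its identity. On $\mathbf{Ope}$ and on $\mathbf{Ope}_\Sigma$ consider the following classes of morphisms $F:P\to Q$: - weak equivalences: $j^*F$ is essentially surjective, and all maps $F:P(p_1,\dots,p_n;p_0)\to Q(Fp_1,\dots,Fp_n;Fp_0)$ are bijective; - cofibrations: $F$ is injective on objects; - fibrations: for each object $p$ of $P$ and each isomorphism $\psi:Fp\to q$ in $Q$ there is an isomorphism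 $\varphi:p\to p'$ in $P$ with $F\varphi=\psi$. A morphism of the slice category $\mathbf{Ope}/\star$ or $\mathbf{Ope}_\Sigma/\star$ is a weak equivalence, a cofibration or a fibration of the slice structure if its underlying functor of operads is one. On the category $\mathbf{Cat}$ of small categories, Rezk's folk model structure has as weak equivalences the equivalences of categories, as cofibrations the functors that are injective on objects, and as fibrations the functors $F:C\to D$ such that for each object $c$ of $C$ and each isomorphism $\psi:Fc\to d$ in $D$ there is an isomorphism $\varphi:c\to c'$ in $C$ with $F\varphi=\psi$. **Theorem.** The three classes of Rezk's structure form a Quillen model structure on $\mathbf{Cat}$. The functors $\mathbf{Ope}/\star\to\mathbf{Cat}$ and $\mathbf{Ope}_\Sigma/\star\to\mathbf{Cat}$, $(P\to\star)\mapsto j^*P$, are isomorphisms of categories. The three classes of each slice structure form a Quillen model structure (the slice category has all small limits and colimits, and the classes satisfy the three for two, retract, lifting and factorization axioms), and each of these isomorphisms identifies the weak equivalences, cofibrations and fibrations of the slice structure with those of Rezk's folk model structure on $\mathbf{Cat}$. -/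

import Mathlib

open CategoryTheory CategoryTheory.Limits

universe u

/-! ### Operads (multicategories) -/

/-- The concatenation of a family of finite sequences `q i : Fin (k i) → A`, in the order
`q 0 0, q 0 1, …, q 1 0, q 1 1, …` (`finSigmaFinEquiv` is the lexicographic enumeration). -/
def joinSeq {A : Type u} {n : ℕ} {k : Fin n → ℕ} (q : ∀ i, Fin (k i) → A) :
    Fin (∑ i, k i) → A :=
  fun x => q (finSigmaFinEquiv.symm x).1 (finSigmaFinEquiv.symm x).2

/-- A (small) non-symmetric coloured operad, also called a multicategory. `Hom n p a` is the set of
morphisms `p 0, …, p (n - 1) → a`. The two sides of the unit and associativity laws live over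
domains that are equal sequences, but not syntactically equal ones, whence the heterogeneous
equality `≍` (equality up to the transport along that equality of sequences). -/
structure Multicategory where
  Ob : Type u
  Hom : (n : ℕ) → (Fin n → Ob) → Ob → Type u
  id : (a : Ob) → Hom 1 (fun _ => a) a
  comp : {n : ℕ} → {p : Fin n → Ob} → {a : Ob} → {k : Fin n → ℕ} →
    {q : (i : Fin n) → Fin (k i) → Ob} →
    Hom n p a → ((i : Fin n) → Hom (k i) (q i) (p i)) → Hom (∑ i, k i) (joinSeq q) a
  id_comp : ∀ {k : ℕ} {q : Fin k → Ob} {a : Ob} (φ : Hom k q a),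
    comp (id a) (fun _ => φ) ≍ φ
  comp_id : ∀ {n : ℕ} {p : Fin n → Ob} {a : Ob} (ψ : Hom n p a),
    comp ψ (fun i => id (p i)) ≍ ψ
  assoc : ∀ {n : ℕ} {p : Fin n → Ob} {a : Ob} {k : Fin n → ℕ}
    {q : (i : Fin n) → Fin (k i) → Ob} {l : (i : Fin n) → Fin (k i) → ℕ}
    {r : (i : Fin n) → (j : Fin (k i)) → Fin (l i j) → Ob}
    (ψ : Hom n p a) (φ : (i : Fin n) → Hom (k i) (q i) (p i))
    (χ : (i : Fin n) → (j : Fin (k i)) → Hom (l i j) (r i j) (q i j)),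
    comp (comp ψ φ) (fun x => χ (finSigmaFinEquiv.symm x).1 (finSigmaFinEquiv.symm x).2) ≍
      comp ψ (fun i => comp (φ i) (χ i))

/-- The block permutation induced by a permutation `e` of the blocks of sizes `k i`. -/
def blockPerm {m n : ℕ} (e : Fin m ≃ Fin n) (k : Fin n → ℕ) :
    Fin (∑ i, k (e i)) ≃ Fin (∑ i, k i) :=
  finSigmaFinEquiv.symm.trans
    ((Equiv.sigmaCongrLeft (β := fun i => Fin (k i)) e).trans finSigmaFinEquiv)

/-- The block sum of permutations `τ i` of the individual blocks. -/
def sumPerm {n : ℕ} {k' k : Fin n → ℕ} (τ : ∀ i, Fin (k' i) ≃ Fin (k i)) :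
    Fin (∑ i, k' i) ≃ Fin (∑ i, k i) :=
  finSigmaFinEquiv.symm.trans ((Equiv.sigmaCongrRight τ).trans finSigmaFinEquiv)

/-- A (small) symmetric coloured operad. `act σ ψ` is `σ^* ψ`. The action is written for
bijections `Fin m ≃ Fin n`: these exist only for `m = n`, so they are permutations; this form only
avoids transports between arities that are equal but not syntactically equal. -/
structure SymMulticategory extends Multicategory.{u} where
  act : {m n : ℕ} → (σ : Fin m ≃ Fin n) → {p : Fin n → Ob} → {a : Ob} →
    Hom n p a → Hom m (fun i => p (σ i)) a
  act_refl : ∀ {n : ℕ} {p : Fin n → Ob} {a : Ob} (ψ : Hom n p a),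
    act (Equiv.refl (Fin n)) ψ = ψ
  act_trans : ∀ {l m n : ℕ} (τ : Fin l ≃ Fin m) (σ : Fin m ≃ Fin n) {p : Fin n → Ob} {a : Ob}
    (ψ : Hom n p a), act (τ.trans σ) ψ = act τ (act σ ψ)
  act_comp : ∀ {m n : ℕ} (σ : Fin m ≃ Fin n) {p : Fin n → Ob} {a : Ob} {k : Fin n → ℕ}
    {q : (i : Fin n) → Fin (k i) → Ob} (ψ : Hom n p a)
    (φ : (i : Fin n) → Hom (k i) (q i) (p i)),
    comp (act σ ψ) (fun i => φ (σ i)) ≍ act (blockPerm σ k) (comp ψ φ)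
  comp_act : ∀ {n : ℕ} {p : Fin n → Ob} {a : Ob} {k' k : Fin n → ℕ}
    {q : (i : Fin n) → Fin (k i) → Ob} (τ : (i : Fin n) → Fin (k' i) ≃ Fin (k i))
    (ψ : Hom n p a) (φ : (i : Fin n) → Hom (k i) (q i) (p i)),
    comp ψ (fun i => act (τ i) (φ i)) ≍ act (sumPerm τ) (comp ψ φ)

/-- Functors of non-symmetric operads. -/
@[ext]
structure MultiFunctor (P Q : Multicategory.{u}) where
  obj : P.Ob → Q.Ob
  map : {n : ℕ} → {p : Fin n → P.Ob} → {a : P.Ob} →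
    P.Hom n p a → Q.Hom n (fun i => obj (p i)) (obj a)
  map_id : ∀ a : P.Ob, map (P.id a) = Q.id (obj a)
  map_comp : ∀ {n : ℕ} {p : Fin n → P.Ob} {a : P.Ob} {k : Fin n → ℕ}
    {q : (i : Fin n) → Fin (k i) → P.Ob} (ψ : P.Hom n p a)
    (φ : (i : Fin n) → P.Hom (k i) (q i) (p i)),
    map (P.comp ψ φ) = Q.comp (q := fun i j => obj (q i j)) (map ψ) (fun i => map (φ i))

/-- Functors of symmetric operads: they also respect the symmetric group actions. -/
@[ext]
structure SymMultiFunctor (P Q : SymMulticategory.{u}) extends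
    MultiFunctor P.toMulticategory Q.toMulticategory where
  map_act : ∀ {m n : ℕ} (σ : Fin m ≃ Fin n) {p : Fin n → P.Ob} {a : P.Ob} (ψ : P.Hom n p a),
    map (P.act σ ψ) = Q.act σ (map ψ)

/-- The identity functor. -/
def MultiFunctor.id (P : Multicategory.{u}) : MultiFunctor P P where
  obj a := a
  map ψ := ψ
  map_id _ := rfl
  map_comp _ _ := rfl

/-- Composition of functors, in diagrammatic order. -/
def MultiFunctor.comp {P Q R : Multicategory.{u}} (F : MultiFunctor P Q) (G : MultiFunctor Q R) :
    MultiFunctor P R where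
  obj a := G.obj (F.obj a)
  map ψ := G.map (F.map ψ)
  map_id a := by rw [F.map_id, G.map_id]
  map_comp ψ φ := (congrArg G.map (F.map_comp ψ φ)).trans (G.map_comp (F.map ψ) _)

/-- The identity functor. -/
def SymMultiFunctor.id (P : SymMulticategory.{u}) : SymMultiFunctor P P where
  toMultiFunctor := MultiFunctor.id P.toMulticategory
  map_act _ _ _ _ := rfl

/-- Composition of functors, in diagrammatic order. -/
def SymMultiFunctor.comp {P Q R : SymMulticategory.{u}} (F : SymMultiFunctor P Q)
    (G : SymMultiFunctor Q R) : SymMultiFunctor P R where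
  toMultiFunctor := F.toMultiFunctor.comp G.toMultiFunctor
  map_act σ _ _ ψ := by
    change G.map (F.map _) = _
    rw [F.map_act, G.map_act]
    rfl

/-! ### The categories `Ope` and `OpeSigma`

In set theory the empty set is unique, and the isomorphisms `Ope/⋆ ≅ Cat`, `Ope_Σ/⋆ ≅ Cat` (as
opposed to mere equivalences) rest on that: the hom-sets of arity `≠ 1` of an operad over `⋆` are
all `∅`. In Lean's type theory two empty types can be neither proved nor refuted to be equal.
So the objects of `Ope` and `OpeSigma` carry the convention that a hom-set of arity `≠ 1` which
is empty is *the* empty type `PEmpty`. This restricts nothing else: hom-sets that are not empty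
are arbitrary, and every operad is isomorphic to one of this form, see
`Multicategory.exists_ope` and `SymMulticategory.exists_opeSigma`. -/

/-- The objects of the category of (small) non-symmetric operads. -/
structure Ope extends Multicategory.{u} where
  eq_pempty : ∀ {n : ℕ} {p : Fin n → Ob} {a : Ob}, n ≠ 1 → IsEmpty (Hom n p a) →
    Hom n p a = PEmpty.{u + 1}

/-- The objects of the category of (small) symmetric operads. -/
structure OpeSigma extends SymMulticategory.{u} where
  eq_pempty : ∀ {n : ℕ} {p : Fin n → Ob} {a : Ob}, n ≠ 1 → IsEmpty (Hom n p a) →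
    Hom n p a = PEmpty.{u + 1}

/-- `T` itself, unless `n ≠ 1` and `T` is empty, in which case `PEmpty`. -/
def NormalHom (n : ℕ) (T : Type u) : Type u :=
  open Classical in if n ≠ 1 ∧ IsEmpty T then PEmpty else T

/-- The identity map `T → NormalHom n T`. -/
def NormalHom.down (n : ℕ) {T : Type u} (x : T) : NormalHom n T :=
  cast (if_neg fun h => h.2.elim x).symm x

theorem NormalHom.eq_of_elem {n : ℕ} {T : Type u} (x : NormalHom n T) : NormalHom n T = T := by
  by_cases h : n ≠ 1 ∧ IsEmpty T
  · exact (cast (if_pos h : NormalHom n T = PEmpty.{u + 1}) x).elim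
  · exact if_neg h

/-- The identity map `NormalHom n T → T`. -/
def NormalHom.up {n : ℕ} {T : Type u} (x : NormalHom n T) : T := cast x.eq_of_elem x

theorem NormalHom.down_heq (n : ℕ) {T : Type u} (x : T) : down n x ≍ x := cast_heq _ _

theorem NormalHom.up_down (n : ℕ) {T : Type u} (x : T) : (down n x).up = x :=
  eq_of_heq ((cast_heq _ _).trans (cast_heq _ _))

theorem NormalHom.down_up {n : ℕ} {T : Type u} (x : NormalHom n T) : down n x.up = x :=
  eq_of_heq ((cast_heq _ _).trans (cast_heq _ _))

theorem NormalHom.down_congr {m n : ℕ} {S T : Type u} {x : S} {y : T} (h : x ≍ y) :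
    down m x ≍ down n y :=
  ((down_heq m x).trans h).trans (down_heq n y).symm

theorem NormalHom.eq_pempty {n : ℕ} {T : Type u} (h : n ≠ 1) (hT : IsEmpty (NormalHom n T)) :
    NormalHom n T = PEmpty.{u + 1} :=
  if_pos ⟨h, ⟨fun x => hT.elim (down n x)⟩⟩

/-- The operad `P` with its empty hom-sets of arity `≠ 1` replaced by `PEmpty`. -/
def Multicategory.normalize (P : Multicategory.{u}) : Multicategory.{u} where
  Ob := P.Ob
  Hom n p a := NormalHom n (P.Hom n p a)
  id a := NormalHom.down 1 (P.id a)
  comp ψ φ := NormalHom.down _ (P.comp ψ.up fun i => (φ i).up)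
  id_comp φ := by
    simp only [NormalHom.up_down]
    exact (NormalHom.down_congr (P.id_comp φ.up)).trans (heq_of_eq φ.down_up)
  comp_id ψ := by
    simp only [NormalHom.up_down]
    exact (NormalHom.down_congr (P.comp_id ψ.up)).trans (heq_of_eq ψ.down_up)
  assoc ψ φ χ := by
    simp only [NormalHom.up_down]
    exact NormalHom.down_congr (P.assoc ψ.up (fun i => (φ i).up) fun i j => (χ i j).up)

/-- The symmetric version of `Multicategory.normalize`. -/
def SymMulticategory.normalize (P : SymMulticategory.{u}) : SymMulticategory.{u} where
  toMulticategory := P.toMulticategory.normalize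
  act σ _ _ ψ := NormalHom.down _ (P.act σ (NormalHom.up ψ))
  act_refl ψ :=
    (congrArg (NormalHom.down _) (P.act_refl (NormalHom.up ψ))).trans (NormalHom.down_up ψ)
  act_trans τ σ _ _ ψ := by
    refine (congrArg (NormalHom.down _) (P.act_trans τ σ (NormalHom.up ψ))).trans ?_
    exact congrArg (fun x => NormalHom.down _ (P.act τ x)) (NormalHom.up_down _ _).symm
  act_comp σ _ _ _ _ ψ φ := by
    simp only [Multicategory.normalize, NormalHom.up_down]
    exact NormalHom.down_congr (P.act_comp σ (NormalHom.up ψ) fun i => (φ i).up)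
  comp_act τ ψ φ := by
    simp only [Multicategory.normalize, NormalHom.up_down]
    exact NormalHom.down_congr (P.comp_act τ (NormalHom.up ψ) fun i => (φ i).up)

/-- Every non-symmetric operad is isomorphic to an object of `Ope`. -/
theorem Multicategory.exists_ope (P : Multicategory.{u}) :
    ∃ (Q : Ope.{u}) (F : MultiFunctor P Q.toMulticategory)
      (G : MultiFunctor Q.toMulticategory P),
      F.comp G = MultiFunctor.id P ∧ G.comp F = MultiFunctor.id Q.toMulticategory := by
  refine ⟨⟨P.normalize, fun h hT => NormalHom.eq_pempty h hT⟩,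
    { obj := fun a => a
      map := fun ψ => NormalHom.down _ ψ
      map_id := fun _ => rfl
      map_comp := fun ψ φ => ?_ },
    { obj := fun a => a
      map := fun ψ => NormalHom.up ψ
      map_id := fun a => NormalHom.up_down 1 (P.id a)
      map_comp := fun ψ φ => NormalHom.up_down _ _ }, ?_, ?_⟩
  · simp only [Multicategory.normalize, NormalHom.up_down]
  · simp only [MultiFunctor.comp, MultiFunctor.id, NormalHom.up_down]
  · refine MultiFunctor.ext rfl (heq_of_eq ?_)
    funext n p a ψ
    exact NormalHom.down_up ψ

/-- Every symmetric operad is isomorphic to an object of `OpeSigma`. -/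
theorem SymMulticategory.exists_opeSigma (P : SymMulticategory.{u}) :
    ∃ (Q : OpeSigma.{u}) (F : SymMultiFunctor P Q.toSymMulticategory)
      (G : SymMultiFunctor Q.toSymMulticategory P),
      F.comp G = SymMultiFunctor.id P ∧ G.comp F = SymMultiFunctor.id Q.toSymMulticategory := by
  refine ⟨⟨P.normalize, fun h hT => NormalHom.eq_pempty h hT⟩,
    { obj := fun a => a
      map := fun ψ => NormalHom.down _ ψ
      map_id := fun _ => rfl
      map_comp := fun ψ φ => ?_
      map_act := fun σ _ _ ψ => ?_ },
    { obj := fun a => a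
      map := fun ψ => NormalHom.up ψ
      map_id := fun a => NormalHom.up_down 1 (P.id a)
      map_comp := fun ψ φ => NormalHom.up_down _ _
      map_act := fun σ _ _ ψ => NormalHom.up_down _ _ }, ?_, ?_⟩
  · simp only [SymMulticategory.normalize, Multicategory.normalize, NormalHom.up_down]
  · exact congrArg (fun x => NormalHom.down _ (P.act σ x)) (NormalHom.up_down _ ψ).symm
  · simp only [SymMultiFunctor.comp, SymMultiFunctor.id, MultiFunctor.comp, MultiFunctor.id,
      NormalHom.up_down]
  · refine SymMultiFunctor.ext rfl (heq_of_eq ?_)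
    funext n p a ψ
    exact NormalHom.down_up ψ

instance : Category.{u} Ope.{u} where
  Hom P Q := MultiFunctor P.toMulticategory Q.toMulticategory
  id P := MultiFunctor.id P.toMulticategory
  comp F G := F.comp G

instance : Category.{u} OpeSigma.{u} where
  Hom P Q := SymMultiFunctor P.toSymMulticategory Q.toSymMulticategory
  id P := SymMultiFunctor.id P.toSymMulticategory
  comp F G := F.comp G

/-- The functor forgetting the symmetric group actions. -/
def OpeSigma.forget : OpeSigma.{u} ⥤ Ope.{u} where
  obj P := ⟨P.toMulticategory, P.eq_pempty⟩
  map F := SymMultiFunctor.toMultiFunctor F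

/-! ### The underlying category of an operad -/

namespace Multicategory

variable (P : Multicategory.{u})

/-- The type of objects of `P`, to carry the underlying category of `P`. -/
def Unary : Type u := P.Ob

/-- The composite of two unary morphisms, seen as a unary morphism. -/
def unaryComp {a b c : P.Ob} (g : P.Hom 1 (fun _ => b) c) (f : P.Hom 1 (fun _ => a) b) :
    P.Hom 1 (fun _ => a) c :=
  cast (by
    have key : ∀ m : ℕ, m = 1 → P.Hom m (fun _ => a) c = P.Hom 1 (fun _ => a) c := by
      rintro m rfl; rfl
    exact key _ (by simp))
    (P.comp (k := fun _ => 1) (q := fun _ _ => a) g (fun _ => f))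

theorem unaryComp_heq {a b c : P.Ob} (g : P.Hom 1 (fun _ => b) c)
    (f : P.Hom 1 (fun _ => a) b) :
    P.unaryComp g f ≍ P.comp (k := fun _ => 1) (q := fun _ _ => a) g (fun _ => f) :=
  cast_heq _ _

theorem comp_congr_left {a b c : P.Ob} {n n' : ℕ} (h : n = n') {g : P.Hom n (fun _ => b) c}
    {g' : P.Hom n' (fun _ => b) c} (hg : g ≍ g') (f : P.Hom 1 (fun _ => a) b) :
    P.comp (k := fun _ => 1) (q := fun _ _ => a) g (fun _ => f) ≍
      P.comp (k := fun _ => 1) (q := fun _ _ => a) g' (fun _ => f) := by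
  subst h; cases hg; rfl

theorem comp_congr_right {a b c : P.Ob} {n n' : ℕ} (h : n = n') (g : P.Hom 1 (fun _ => b) c)
    {f : P.Hom n (fun _ => a) b} {f' : P.Hom n' (fun _ => a) b} (hf : f ≍ f') :
    P.comp (k := fun _ => n) (q := fun _ _ => a) g (fun _ => f) ≍
      P.comp (k := fun _ => n') (q := fun _ _ => a) g (fun _ => f') := by
  subst h; cases hf; rfl

/-- The underlying category of an operad: its unary morphisms. -/
instance : Category.{u} P.Unary where
  Hom a b := P.Hom 1 (fun _ => a) b
  id a := P.id a
  comp f g := P.unaryComp g f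
  id_comp {a b} f := eq_of_heq ((P.unaryComp_heq f (P.id a)).trans (P.comp_id f))
  comp_id {a b} f := eq_of_heq ((P.unaryComp_heq (P.id b) f).trans (P.id_comp f))
  assoc {a b c d} f g h := by
    refine eq_of_heq ?_
    refine (P.unaryComp_heq h (P.unaryComp g f)).trans ?_
    refine HEq.trans ?_ (P.unaryComp_heq (P.unaryComp h g) f).symm
    refine (P.comp_congr_right (by simp) h (P.unaryComp_heq g f)).trans ?_
    refine HEq.trans ?_ (P.comp_congr_left (by simp) (P.unaryComp_heq h g) f).symm
    exact (P.assoc (k := fun _ => 1) (q := fun _ _ => b) (l := fun _ _ => 1)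
      (r := fun _ _ _ => a) h (fun _ => g) (fun _ _ => f)).symm

end Multicategory

theorem MultiFunctor.map_unaryComp {P Q : Multicategory.{u}} (F : MultiFunctor P Q) {a b c : P.Ob}
    (g : P.Hom 1 (fun _ => b) c) (f : P.Hom 1 (fun _ => a) b) :
    F.map (P.unaryComp g f) = Q.unaryComp (F.map g) (F.map f) := by
  have key : ∀ {n n' : ℕ}, n = n' → ∀ {x : P.Hom n (fun _ => a) c} {y : P.Hom n' (fun _ => a) c},
      x ≍ y → F.map x ≍ F.map y := by
    rintro n n' rfl x y h; cases h; rfl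
  refine eq_of_heq ((key (by simp) (P.unaryComp_heq g f)).trans ?_)
  refine HEq.trans ?_ (Q.unaryComp_heq (F.map g) (F.map f)).symm
  exact heq_of_eq (F.map_comp (k := fun _ => 1) (q := fun _ _ => a) g (fun _ => f))

/-- The functor between underlying categories induced by a functor of operads. -/
def MultiFunctor.unary {P Q : Multicategory.{u}} (F : MultiFunctor P Q) : P.Unary ⥤ Q.Unary where
  obj := F.obj
  map f := F.map f
  map_id a := F.map_id a
  map_comp f g := F.map_unaryComp g f

/-- The functor `j^* : Ope ⥤ Cat`. -/
def Ope.jStar : Ope.{u} ⥤ Cat.{u, u} where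
  obj P := Cat.of P.toMulticategory.Unary
  map F := (MultiFunctor.unary F).toCatHom

/-- The functor `j^* : OpeSigma ⥤ Cat`. -/
def OpeSigma.jStar : OpeSigma.{u} ⥤ Cat.{u, u} := OpeSigma.forget ⋙ Ope.jStar

/-! ### The operad `⋆` -/

/-- The hom-sets of `⋆`: a single morphism in arity one, and none in the other arities. -/
def StarHom : ℕ → Type u
  | 1 => PUnit
  | _ => PEmpty

theorem StarHom.arity {n : ℕ} (x : StarHom.{u} n) : n = 1 := by
  match n, x with
  | 1, _ => rfl

/-- The morphism of `⋆`. -/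
def StarHom.mk {n : ℕ} (h : n = 1) : StarHom.{u} n := h ▸ (PUnit.unit : StarHom.{u} 1)

theorem StarHom.heq {m n : ℕ} (x : StarHom.{u} m) (y : StarHom.{u} n) : x ≍ y := by
  obtain rfl := x.arity
  obtain rfl := y.arity
  exact heq_of_eq (Subsingleton.elim (α := PUnit) x y)

/-- The operad with one object and one morphism, its identity. -/
def starMulticategory : Multicategory.{u} where
  Ob := PUnit
  Hom n _ _ := StarHom n
  id _ := StarHom.mk rfl
  comp {n p a k q} ψ φ := StarHom.mk (by
    obtain rfl := ψ.arity
    simpa using (φ 0).arity)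
  id_comp _ := StarHom.heq _ _
  comp_id _ := StarHom.heq _ _
  assoc _ _ _ := StarHom.heq _ _

/-- The same operad, as a symmetric operad. -/
def starSymMulticategory : SymMulticategory.{u} where
  toMulticategory := starMulticategory
  act {m n} σ _ _ ψ := StarHom.mk (n := m)
    ((Fin.equiv_iff_eq.mp ⟨σ⟩).trans (StarHom.arity (n := n) ψ))
  act_refl _ := eq_of_heq (StarHom.heq _ _)
  act_trans _ _ _ _ _ := eq_of_heq (StarHom.heq _ _)
  act_comp _ _ _ _ _ _ _ := StarHom.heq _ _
  comp_act _ _ _ := StarHom.heq _ _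

theorem StarHom.eq_pempty {n : ℕ} (h : n ≠ 1) : StarHom.{u} n = PEmpty.{u + 1} := by
  match n, h with
  | 0, _ => rfl
  | _ + 2, _ => rfl

/-- The operad `⋆` in `Ope`. -/
def Ope.star : Ope.{u} := ⟨starMulticategory, fun h _ => StarHom.eq_pempty h⟩

/-- The operad `⋆` in `OpeSigma`. -/
def OpeSigma.star : OpeSigma.{u} := ⟨starSymMulticategory, fun h _ => StarHom.eq_pempty h⟩

/-! ### Quillen model structures -/

/-- A specification of three classes of morphisms of a category. -/
@[ext]
structure ModelClasses (C : Type*) [Category C] where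
  weakEquivalences : MorphismProperty C
  cofibrations : MorphismProperty C
  fibrations : MorphismProperty C

namespace ModelClasses

variable {C : Type*} [Category C]

/-- The three classes form a Quillen model structure (`w` is the size of small (co)limits). -/
structure IsModelStructure.{w, v, u'} {C : Type u'} [Category.{v} C] (M : ModelClasses C) :
    Prop where
  complete : HasLimitsOfSize.{w, w} C
  cocomplete : HasColimitsOfSize.{w, w} C
  threeForTwo : M.weakEquivalences.HasTwoOutOfThreeProperty
  retract_weakEquivalences : M.weakEquivalences.IsStableUnderRetracts
  retract_cofibrations : M.cofibrations.IsStableUnderRetracts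
  retract_fibrations : M.fibrations.IsStableUnderRetracts
  lift_of_trivial_cofibration : ∀ {a b c d : C} (i : a ⟶ b) (p : c ⟶ d),
    M.cofibrations i → M.weakEquivalences i → M.fibrations p → HasLiftingProperty i p
  lift_of_trivial_fibration : ∀ {a b c d : C} (i : a ⟶ b) (p : c ⟶ d),
    M.cofibrations i → M.fibrations p → M.weakEquivalences p → HasLiftingProperty i p
  factor_trivial_fibration : MorphismProperty.HasFactorization M.cofibrations
    (M.fibrations ⊓ M.weakEquivalences)
  factor_trivial_cofibration : MorphismProperty.HasFactorization
    (M.cofibrations ⊓ M.weakEquivalences) M.fibrations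

/-- The classes of those morphisms that `F` sends into the given classes. -/
def inverseImage {D : Type*} [Category D] (M : ModelClasses D) (F : C ⥤ D) : ModelClasses C where
  weakEquivalences := M.weakEquivalences.inverseImage F
  cofibrations := M.cofibrations.inverseImage F
  fibrations := M.fibrations.inverseImage F

/-- The slice classes: a morphism over `X` belongs to one of them if and only if its underlying
morphism does. -/
def slice (M : ModelClasses C) (X : C) : ModelClasses (Over X) := M.inverseImage (Over.forget X)

end ModelClasses

/-- Every isomorphism `ψ : F c ≅ d` is `F φ` for some isomorphism `φ : c ≅ c'` (thus `F c' = d`). -/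
def IsIsofibration {C D : Type*} [Category C] [Category D] (F : C ⥤ D) : Prop :=
  ∀ (c : C) (d : D) (ψ : F.obj c ≅ d), ∃ (c' : C) (φ : c ≅ c') (h : F.obj c' = d),
    F.map φ.hom ≫ eqToHom h = ψ.hom

/-- The classes of Rezk's folk model structure on `Cat`. -/
def folkCat : ModelClasses Cat.{u, u} where
  weakEquivalences _ _ F := F.toFunctor.IsEquivalence
  cofibrations _ _ F := Function.Injective F.toFunctor.obj
  fibrations _ _ F := IsIsofibration F.toFunctor

/-- A functor of operads is fully faithful if it is bijective on all hom-sets, of any arity. -/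
def MultiFunctor.IsFullyFaithful {P Q : Multicategory.{u}} (F : MultiFunctor P Q) : Prop :=
  ∀ (n : ℕ) (p : Fin n → P.Ob) (a : P.Ob),
    Function.Bijective (F.map : P.Hom n p a → Q.Hom n (fun i => F.obj (p i)) (F.obj a))

/-- The classes of a functor of operads: operadic equivalences (essentially surjective and fully
faithful functors), functors that are injective on objects, and functors that lift isomorphisms.
Isomorphisms in an operad are those in its underlying category. -/
def folkOpe : ModelClasses Ope.{u} where
  weakEquivalences _ _ F := (MultiFunctor.unary F).EssSurj ∧ MultiFunctor.IsFullyFaithful F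
  cofibrations _ _ F := Function.Injective (MultiFunctor.obj F)
  fibrations _ _ F := IsIsofibration (MultiFunctor.unary F)

/-- The classes for symmetric operads, given by the same conditions. -/
def folkOpeSigma : ModelClasses OpeSigma.{u} := folkOpe.inverseImage OpeSigma.forget

/-- The functor `Ope/⋆ ⥤ Cat`, `(P → ⋆) ↦ j^* P`. -/
def Ope.sliceToCat : Over Ope.star.{u} ⥤ Cat.{u, u} := Over.forget Ope.star.{u} ⋙ Ope.jStar.{u}

/-- The functor `Ope_Σ/⋆ ⥤ Cat`, `(P → ⋆) ↦ j^* P`. -/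
def OpeSigma.sliceToCat : Over OpeSigma.star.{u} ⥤ Cat.{u, u} :=
  Over.forget OpeSigma.star.{u} ⋙ OpeSigma.jStar.{u}

/-! ### Lifting properties of functors -/

namespace CategoryTheory.Functor

variable {A B C D : Type*} [Category A] [Category B] [Category C] [Category D]

/-- A faithful functor can be cancelled on the right from an equality of functors, provided that
the functors agree on objects. -/
theorem eq_of_comp_eq_of_faithful {F G : A ⥤ C} (p : C ⥤ D) [p.Faithful]
    (hobj : ∀ a, F.obj a = G.obj a) (h : F ⋙ p = G ⋙ p) : F = G := by
  refine Functor.ext hobj fun a b f => p.map_injective ?_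
  have := congr_hom h f
  simp only [comp_obj, comp_map] at this
  simp [this, eqToHom_map]

/-- A functor lifts along a fully faithful functor as soon as it does so on objects. -/
theorem exists_lift_of_fullyFaithful (p : C ⥤ D) [p.Full] [p.Faithful] (v : B ⥤ D) (o : B → C)
    (ho : ∀ b, p.obj (o b) = v.obj b) :
    ∃ l : B ⥤ C, (∀ b, l.obj b = o b) ∧ l ⋙ p = v := by
  refine ⟨{ obj := o
            map := fun {b b'} f => p.preimage (eqToHom (ho b) ≫ v.map f ≫ eqToHom (ho b').symm)
            map_id := fun b => p.map_injective (by simp)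
            map_comp := fun f g => p.map_injective (by simp) }, fun _ => rfl, ?_⟩
  exact Functor.ext ho fun b b' f => by simp

theorem exists_lift_of_surjective_equivalence (i : A ⥤ B) (p : C ⥤ D)
    (hi : Function.Injective i.obj) [p.Full] [p.Faithful] (hp : Function.Surjective p.obj)
    (t : A ⥤ C) (v : B ⥤ D) (h : t ⋙ p = i ⋙ v) :
    ∃ l : B ⥤ C, i ⋙ l = t ∧ l ⋙ p = v := by
  have key : ∀ b, ∃ c, p.obj c = v.obj b ∧ ∀ a, i.obj a = b → c = t.obj a := by
    intro b
    by_cases hb : ∃ a, i.obj a = b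
    · obtain ⟨a, rfl⟩ := hb
      exact ⟨t.obj a, congr_obj h a, fun a' ha' => by rw [hi ha']⟩
    · obtain ⟨c, hc⟩ := hp (v.obj b)
      exact ⟨c, hc, fun a ha => (hb ⟨a, ha⟩).elim⟩
  choose o ho ho' using key
  obtain ⟨l, hl, hlv⟩ := exists_lift_of_fullyFaithful p v o ho
  refine ⟨l, eq_of_comp_eq_of_faithful p (fun a => ?_) ?_, hlv⟩
  · exact (hl _).trans (ho' _ a rfl)
  · rw [Functor.assoc, hlv, h]

/-- An object `c` which lifts `v.obj b`, together with the choice of an object `a` of `A` with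
`i.obj a ≅ b` and a lift `t.obj a ≅ c` of that isomorphism. -/
structure IsoLiftData (i : A ⥤ B) (p : C ⥤ D) (t : A ⥤ C) (v : B ⥤ D) (h : t ⋙ p = i ⋙ v)
    (b : B) where
  a : A
  e : i.obj a ≅ b
  c : C
  φ : t.obj a ≅ c
  obj_eq : p.obj c = v.obj b
  map_eq : p.map φ.hom ≫ eqToHom obj_eq = eqToHom (congr_obj h a) ≫ v.map e.hom

namespace IsoLiftData

variable {i : A ⥤ B} {p : C ⥤ D} {t : A ⥤ C} {v : B ⥤ D} {h : t ⋙ p = i ⋙ v}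

/-- The trivial choice at an object in the image of `i`. -/
def refl (a : A) : IsoLiftData i p t v h (i.obj a) where
  a := a
  e := Iso.refl _
  c := t.obj a
  φ := Iso.refl _
  obj_eq := congr_obj h a
  map_eq := by simp

theorem map_hom {b : B} (d : IsoLiftData i p t v h b) :
    p.map d.φ.hom = eqToHom (congr_obj h d.a) ≫ v.map d.e.hom ≫ eqToHom d.obj_eq.symm := by
  rw [← reassoc_of% d.map_eq]
  simp

theorem map_inv {b : B} (d : IsoLiftData i p t v h b) :
    p.map d.φ.inv = eqToHom d.obj_eq ≫ v.map d.e.inv ≫ eqToHom (congr_obj h d.a).symm := by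
  rw [← cancel_epi (p.map d.φ.hom), ← p.map_comp, d.map_hom]
  simp [← v.map_comp_assoc]

variable [i.Full] [i.Faithful]

/-- The functor determined by choices for all objects of `B`. -/
noncomputable def lift (d : ∀ b, IsoLiftData i p t v h b) : B ⥤ C where
  obj b := (d b).c
  map {b b'} w := (d b).φ.inv ≫ t.map (i.preimage ((d b).e.hom ≫ w ≫ (d b').e.inv)) ≫ (d b').φ.hom
  map_id b := by simp
  map_comp {b b' b''} f g := by
    have : i.preimage ((d b).e.hom ≫ (f ≫ g) ≫ (d b'').e.inv) =
        i.preimage ((d b).e.hom ≫ f ≫ (d b').e.inv) ≫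
          i.preimage ((d b').e.hom ≫ g ≫ (d b'').e.inv) := i.map_injective (by simp)
    rw [this]
    simp

theorem lift_comp (d : ∀ b, IsoLiftData i p t v h b) : lift d ⋙ p = v := by
  refine Functor.ext (fun b => (d b).obj_eq) fun b b' w => ?_
  have := congr_hom h (i.preimage ((d b).e.hom ≫ w ≫ (d b').e.inv))
  simp only [comp_obj, comp_map, map_preimage] at this
  simp [lift, map_hom, map_inv, this]

theorem comp_lift (d : ∀ b, IsoLiftData i p t v h b) (hd : ∀ a, d (i.obj a) = refl a) :
    i ⋙ lift d = t := by
  refine Functor.hext (fun a => ?_) fun a a' f => ?_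
  · change (d (i.obj a)).c = _
    rw [hd]
    rfl
  · change (d _).φ.inv ≫ t.map (i.preimage ((d _).e.hom ≫ i.map f ≫ (d _).e.inv)) ≫ (d _).φ.hom ≍ _
    rw [hd a, hd a']
    simp [refl]

end IsoLiftData

end CategoryTheory.Functor

section Isofibration

variable {A B C D : Type*} [Category A] [Category B] [Category C] [Category D]

open Functor

theorem IsIsofibration.exists_lift {i : A ⥤ B} {p : C ⥤ D} (hp : IsIsofibration p)
    (hi : Function.Injective i.obj) [i.IsEquivalence]
    (t : A ⥤ C) (v : B ⥤ D) (h : t ⋙ p = i ⋙ v) :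
    ∃ l : B ⥤ C, i ⋙ l = t ∧ l ⋙ p = v := by
  have key : ∀ b, ∃ d : IsoLiftData i p t v h b,
      ∀ a (ha : i.obj a = b), d = ha ▸ IsoLiftData.refl a := by
    intro b
    by_cases hb : ∃ a, i.obj a = b
    · obtain ⟨a, rfl⟩ := hb
      refine ⟨IsoLiftData.refl a, fun a' ha' => ?_⟩
      obtain rfl := hi ha'
      rfl
    · obtain ⟨c, φ, hc, hφ⟩ := hp (t.obj (i.objPreimage b)) (v.obj b)
        (eqToIso (congr_obj h _) ≪≫ v.mapIso (i.objObjPreimageIso b))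
      exact ⟨⟨i.objPreimage b, i.objObjPreimageIso b, c, φ, hc, by simpa using hφ⟩,
        fun a ha => (hb ⟨a, ha⟩).elim⟩
  choose d hd using key
  exact ⟨IsoLiftData.lift d, IsoLiftData.comp_lift d fun a => hd _ a rfl, IsoLiftData.lift_comp d⟩

theorem IsIsofibration.surjective_obj {p : C ⥤ D} (hp : IsIsofibration p) [p.EssSurj] :
    Function.Surjective p.obj := fun d =>
  let ⟨c, _, h, _⟩ := hp _ d (p.objObjPreimageIso d)
  ⟨c, h⟩

theorem IsIsofibration.of_retract {f : A ⥤ B} {g : C ⥤ D} (hg : IsIsofibration g) {i : A ⥤ C}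
    {r : C ⥤ A} {i' : B ⥤ D} {r' : D ⥤ B} (hir : i ⋙ r = 𝟭 A) (hir' : i' ⋙ r' = 𝟭 B)
    (hi : i ⋙ g = f ⋙ i') (hr : r ⋙ f = g ⋙ r') : IsIsofibration f := by
  intro a b ψ
  obtain ⟨x, φ, hx, hφ⟩ := hg (i.obj a) (i'.obj b) (eqToIso (congr_obj hi a) ≪≫ i'.mapIso ψ)
  refine ⟨r.obj x, eqToIso (congr_obj hir a).symm ≪≫ r.mapIso φ, ?_, ?_⟩
  · exact (congr_obj hr x).trans ((congrArg r'.obj hx).trans (congr_obj hir' b))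
  · have h₁ := congr_hom hr φ.hom
    have h₂ := congr_hom hir' ψ.hom
    have h₃ : g.map φ.hom =
        eqToHom (congr_obj hi a) ≫ i'.map ψ.hom ≫ eqToHom hx.symm := by
      rw [← cancel_mono (eqToHom hx), hφ]
      simp
    simp only [comp_obj, Functor.comp_map, id_obj, Functor.id_map] at h₁ h₂
    simp [h₁, h₂, h₃, eqToHom_map]

theorem CategoryTheory.Functor.IsEquivalence.of_retract {f : A ⥤ B} {g : C ⥤ D} [g.IsEquivalence]
    {i : A ⥤ C} {r : C ⥤ A} {i' : B ⥤ D} {r' : D ⥤ B} (hir : i ⋙ r = 𝟭 A)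
    (hir' : i' ⋙ r' = 𝟭 B) (hi : i ⋙ g = f ⋙ i') (hr : r ⋙ f = g ⋙ r') : f.IsEquivalence := by
  refine (CategoryTheory.Equivalence.mk f (i' ⋙ g.inv ⋙ r) ?_ ?_).isEquivalence_functor
  · exact eqToIso hir.symm ≪≫
      isoWhiskerRight (i.rightUnitor.symm ≪≫ isoWhiskerLeft i g.asEquivalence.unitIso) r ≪≫
      eqToIso (congrArg (· ⋙ g.inv ⋙ r) hi)
  · exact eqToIso (congrArg (fun F => i' ⋙ g.inv ⋙ F) hr) ≪≫
      isoWhiskerRight (isoWhiskerLeft i' g.asEquivalence.counitIso ≪≫ i'.rightUnitor) r' ≪≫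
      eqToIso hir'

end Isofibration

/-! ### Factorizations of functors -/

namespace CategoryTheory.Functor

variable {A B : Type u} [Category.{u} A] [Category.{u} B] (F : A ⥤ B)

/-- The mapping cylinder of a functor. -/
abbrev MappingCylinder : Type u := InducedCategory B (Sum.elim F.obj id)

/-- The inclusion of the source in the mapping cylinder. -/
@[simps]
def toMappingCylinder : A ⥤ F.MappingCylinder where
  obj a := Sum.inl a
  map f := ⟨F.map f⟩
  map_id _ := InducedCategory.hom_ext (F.map_id _)
  map_comp _ _ := InducedCategory.hom_ext (F.map_comp _ _)

/-- The projection of the mapping cylinder to the target. -/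
abbrev fromMappingCylinder : F.MappingCylinder ⥤ B := inducedFunctor _

instance : F.fromMappingCylinder.EssSurj where
  mem_essImage b := ⟨Sum.inr b, ⟨Iso.refl _⟩⟩

instance : F.fromMappingCylinder.IsEquivalence where

theorem isIsofibration_fromMappingCylinder : IsIsofibration F.fromMappingCylinder :=
  fun _ d ψ => ⟨Sum.inr d, InducedCategory.isoMk ψ, rfl, Category.comp_id _⟩

/-- The objects of the mapping path category of a functor. -/
structure PathObject where
  a : A
  b : B
  e : F.obj a ≅ b

/-- The mapping path category of a functor. -/
abbrev MappingPath : Type u := InducedCategory A (PathObject.a (F := F))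

/-- The inclusion of the source in the mapping path category. -/
@[simps]
def toMappingPath : A ⥤ F.MappingPath where
  obj a := PathObject.mk a (F.obj a) (Iso.refl _)
  map f := ⟨f⟩

/-- The projection of the mapping path category to the target. -/
@[simps]
def fromMappingPath : F.MappingPath ⥤ B where
  obj x := PathObject.b x
  map {x y} f := (PathObject.e x).inv ≫ F.map f.hom ≫ (PathObject.e y).hom

theorem toMappingPath_comp_fromMappingPath : F.toMappingPath ⋙ F.fromMappingPath = F :=
  Functor.hext (fun _ => rfl) fun a b f => heq_of_eq <| by
    change 𝟙 (F.obj a) ≫ F.map f ≫ 𝟙 (F.obj b) = F.map f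
    simp

instance : F.toMappingPath.IsEquivalence where
  faithful := ⟨fun h => congrArg InducedCategory.Hom.hom h⟩
  full := ⟨fun f => ⟨f.hom, rfl⟩⟩
  essSurj := ⟨fun x => ⟨PathObject.a x, ⟨InducedCategory.isoMk (Iso.refl _)⟩⟩⟩

theorem isIsofibration_fromMappingPath : IsIsofibration F.fromMappingPath :=
  fun x d (ψ : PathObject.b x ≅ d) =>
  ⟨PathObject.mk (PathObject.a x) d (PathObject.e x ≪≫ ψ),
    InducedCategory.isoMk (Iso.refl (PathObject.a x)), rfl, by
      refine (Category.comp_id _).trans ?_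
      change (PathObject.e x).inv ≫ F.map (𝟙 _) ≫ (PathObject.e x).hom ≫ ψ.hom = _
      simp⟩

end CategoryTheory.Functor

/-! ### The folk model structure -/

section Folk

open Functor

theorem folkCat_retract_comp {A B C D : Cat.{u, u}} {f : A ⟶ B} {g : C ⟶ D} (h : RetractArrow f g) :
    (h.i.left.toFunctor ⋙ h.r.left.toFunctor = 𝟭 A ∧
      h.i.right.toFunctor ⋙ h.r.right.toFunctor = 𝟭 B) ∧
    (h.i.left.toFunctor ⋙ g.toFunctor = f.toFunctor ⋙ h.i.right.toFunctor ∧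
      h.r.left.toFunctor ⋙ f.toFunctor = g.toFunctor ⋙ h.r.right.toFunctor) :=
  ⟨⟨congrArg Cat.Hom.toFunctor h.retract_left, congrArg Cat.Hom.toFunctor h.retract_right⟩,
    congrArg Cat.Hom.toFunctor h.i_w, congrArg Cat.Hom.toFunctor h.r_w⟩

theorem Cat.hasLiftingProperty {A B C D : Cat.{u, u}} {i : A ⟶ B} {p : C ⟶ D}
    (H : ∀ (t : A ⥤ C) (v : B ⥤ D), t ⋙ p.toFunctor = i.toFunctor ⋙ v →
      ∃ l : B ⥤ C, i.toFunctor ⋙ l = t ∧ l ⋙ p.toFunctor = v) : HasLiftingProperty i p where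
  sq_hasLift {t v} sq := by
    obtain ⟨l, hl, hl'⟩ := H t.toFunctor v.toFunctor (congrArg Cat.Hom.toFunctor sq.w)
    exact ⟨⟨l.toCatHom, Cat.ext hl, Cat.ext hl'⟩⟩

theorem folkCat_isModelStructure : folkCat.{u}.IsModelStructure.{u} where
  complete := inferInstance
  cocomplete := inferInstance
  threeForTwo :=
    { comp_mem := fun f g (_ : f.toFunctor.IsEquivalence) (_ : g.toFunctor.IsEquivalence) =>
        inferInstanceAs (f.toFunctor ⋙ g.toFunctor).IsEquivalence
      of_postcomp := fun f g (_ : g.toFunctor.IsEquivalence)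
          (_ : (f.toFunctor ⋙ g.toFunctor).IsEquivalence) =>
        isEquivalence_of_comp_right f.toFunctor g.toFunctor
      of_precomp := fun f g (_ : f.toFunctor.IsEquivalence)
          (_ : (f.toFunctor ⋙ g.toFunctor).IsEquivalence) =>
        isEquivalence_of_comp_left f.toFunctor g.toFunctor }
  retract_weakEquivalences := ⟨fun {_ _ _ _ _ g} h (_ : g.toFunctor.IsEquivalence) =>
    have H := folkCat_retract_comp h
    IsEquivalence.of_retract H.1.1 H.1.2 H.2.1 H.2.2⟩
  retract_cofibrations := ⟨fun {_ _ _ _ f g} h hg => by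
    obtain ⟨⟨h₁, -⟩, h₂, -⟩ := folkCat_retract_comp h
    have hi : Function.Injective h.i.left.toFunctor.obj :=
      Function.LeftInverse.injective fun a => congr_obj h₁ a
    have : Function.Injective (f.toFunctor ⋙ h.i.right.toFunctor).obj := by
      rw [← h₂]
      exact fun _ _ hab => hi (hg hab)
    exact Function.Injective.of_comp this⟩
  retract_fibrations := ⟨fun h hg =>
    have H := folkCat_retract_comp h
    IsIsofibration.of_retract hg H.1.1 H.1.2 H.2.1 H.2.2⟩
  lift_of_trivial_cofibration i p hi (_ : i.toFunctor.IsEquivalence) hp :=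
    Cat.hasLiftingProperty fun t v h => IsIsofibration.exists_lift hp hi t v h
  lift_of_trivial_fibration i p hi hp (_ : p.toFunctor.IsEquivalence) :=
    Cat.hasLiftingProperty fun t v h => exists_lift_of_surjective_equivalence
      i.toFunctor p.toFunctor hi (IsIsofibration.surjective_obj hp) t v h
  factor_trivial_fibration := ⟨fun f => ⟨
    { Z := Cat.of f.toFunctor.MappingCylinder
      i := f.toFunctor.toMappingCylinder.toCatHom
      p := f.toFunctor.fromMappingCylinder.toCatHom
      fac := Cat.ext rfl
      hi := fun _ _ h => Sum.inl_injective h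
      hp := ⟨isIsofibration_fromMappingCylinder _,
        inferInstanceAs f.toFunctor.fromMappingCylinder.IsEquivalence⟩ }⟩⟩
  factor_trivial_cofibration := ⟨fun f => ⟨
    { Z := Cat.of f.toFunctor.MappingPath
      i := f.toFunctor.toMappingPath.toCatHom
      p := f.toFunctor.fromMappingPath.toCatHom
      fac := Cat.ext (toMappingPath_comp_fromMappingPath _)
      hi := ⟨fun _ _ h => congrArg PathObject.a h,
        inferInstanceAs f.toFunctor.toMappingPath.IsEquivalence⟩
      hp := isIsofibration_fromMappingPath _ }⟩⟩

end Folk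

/-! ### Transfer along an isomorphism of categories -/

namespace CategoryTheory.Functor

variable {C D : Type*} [Category C] [Category D]

/-- A fully faithful functor that is bijective on objects has a strict inverse. -/
theorem exists_strict_inverse (F : C ⥤ D) [F.Full] [F.Faithful] (h : Function.Bijective F.obj) :
    ∃ G : D ⥤ C, F ⋙ G = 𝟭 C ∧ G ⋙ F = 𝟭 D := by
  obtain ⟨o, ho, ho'⟩ := Function.bijective_iff_has_inverse.mp h
  obtain ⟨G, hG, hGF⟩ := exists_lift_of_fullyFaithful F (𝟭 D) o ho'
  refine ⟨G, eq_of_comp_eq_of_faithful F (fun c => (hG _).trans (ho c)) ?_, hGF⟩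
  rw [Functor.assoc, hGF, CategoryTheory.Functor.comp_id, CategoryTheory.Functor.id_comp]

end CategoryTheory.Functor

namespace ModelClasses

variable {C D : Type*} [Category C] [Category D]

theorem hasLiftingProperty_of_map (F : C ⥤ D) [F.Full] [F.Faithful] {a b c d : C} {i : a ⟶ b}
    {p : c ⟶ d} (h : HasLiftingProperty (F.map i) (F.map p)) : HasLiftingProperty i p where
  sq_hasLift sq := by
    have sq' := sq.map F
    exact ⟨⟨F.preimage sq'.lift, F.map_injective (by simp), F.map_injective (by simp)⟩⟩

theorem hasFactorization_inverseImage {W₁ W₂ : MorphismProperty D} (F : C ⥤ D) [F.Full]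
    [F.Faithful] (hF : Function.Surjective F.obj) (h : W₁.HasFactorization W₂) :
    (W₁.inverseImage F).HasFactorization (W₂.inverseImage F) where
  nonempty_mapFactorizationData f := by
    obtain ⟨Z, i, p, fac, hi, hp⟩ := h.nonempty_mapFactorizationData (F.map f)
    obtain ⟨Z, rfl⟩ := hF Z
    obtain ⟨i, rfl⟩ := F.map_surjective i
    obtain ⟨p, rfl⟩ := F.map_surjective p
    exact ⟨⟨Z, i, p, F.map_injective (by simpa using fac), hi, hp⟩⟩

theorem IsModelStructure.inverseImage.{w} {M : ModelClasses D} (hM : IsModelStructure.{w} M)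
    (F : C ⥤ D) [F.Full] [F.Faithful] (hF : Function.Surjective F.obj) :
    IsModelStructure.{w} (M.inverseImage F) :=
  have : F.EssSurj := ⟨fun d => let ⟨c, hc⟩ := hF d; ⟨c, ⟨eqToIso hc⟩⟩⟩
  have : F.IsEquivalence := { }
  have := hM.complete
  have := hM.cocomplete
  have := hM.threeForTwo
  have := hM.retract_weakEquivalences
  have := hM.retract_cofibrations
  have := hM.retract_fibrations
  { complete := Adjunction.has_limits_of_equivalence F
    cocomplete := Adjunction.has_colimits_of_equivalence F
    threeForTwo := inferInstanceAs (M.weakEquivalences.inverseImage F).HasTwoOutOfThreeProperty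
    retract_weakEquivalences :=
      ⟨fun h hg => M.weakEquivalences.of_retract (h.map F) hg⟩
    retract_cofibrations := ⟨fun h hg => M.cofibrations.of_retract (h.map F) hg⟩
    retract_fibrations := ⟨fun h hg => M.fibrations.of_retract (h.map F) hg⟩
    lift_of_trivial_cofibration := fun _ _ hi hi' hp =>
      hasLiftingProperty_of_map F (hM.lift_of_trivial_cofibration _ _ hi hi' hp)
    lift_of_trivial_fibration := fun _ _ hi hp hp' =>
      hasLiftingProperty_of_map F (hM.lift_of_trivial_fibration _ _ hi hp hp')
    factor_trivial_fibration :=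
      hasFactorization_inverseImage F hF hM.factor_trivial_fibration
    factor_trivial_cofibration :=
      hasFactorization_inverseImage F hF hM.factor_trivial_cofibration }

/-- A category that is isomorphic to `D` through a fully faithful functor, bijective on objects,
has the same model structures as `D`. -/
theorem exists_strict_inverse_and_isModelStructure.{w} {M : ModelClasses D}
    (hM : IsModelStructure.{w} M) (F : C ⥤ D) [F.Full] [F.Faithful] (hF : Function.Bijective F.obj)
    {N : ModelClasses C} (hN : N = M.inverseImage F) :
    ∃ G : D ⥤ C, F ⋙ G = 𝟭 C ∧ G ⋙ F = 𝟭 D ∧ IsModelStructure.{w} N ∧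
      N = M.inverseImage F ∧ N.inverseImage G = M := by
  obtain ⟨G, h₁, h₂⟩ := F.exists_strict_inverse hF
  refine ⟨G, h₁, h₂, hN ▸ hM.inverseImage F hF.2, hN, ?_⟩
  subst hN
  change M.inverseImage (G ⋙ F) = M
  rw [h₂]
  rfl

end ModelClasses

/-! ### Operads all of whose morphisms are unary -/

section UnaryRec

variable {Ob : Type u} {H : (n : ℕ) → (Fin n → Ob) → Ob → Type u}

/-- To treat a morphism of an operad without morphisms of arity `≠ 1`, it suffices to treat those
whose source is a constant sequence of length one. -/
def unaryRec (hH : ∀ {n p a}, H n p a → n = 1) {motive : ∀ {n p a}, H n p a → Sort*}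
    (h : ∀ {a b} (f : H 1 (fun _ => a) b), motive f) {n : ℕ} {p : Fin n → Ob} {a : Ob}
    (ψ : H n p a) : motive ψ := by
  have aux : ∀ (p : Fin 1 → Ob) (x : Ob) (_ : p = fun _ => x) (ψ : H 1 p a), motive ψ := by
    rintro _ x rfl ψ
    exact h ψ
  obtain rfl := hH ψ
  exact aux p (p 0) (funext fun i => congrArg p (Subsingleton.elim i 0)) ψ

/-- The analogue of `unaryRec` for families that are indexed by `Fin 1`. -/
def unaryFamilyRec (hH : ∀ {n p a}, H n p a → n = 1) {b : Ob}
    {motive : ∀ {k : Fin 1 → ℕ} {q : ∀ i, Fin (k i) → Ob}, (∀ i, H (k i) (q i) b) → Sort*}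
    (h : ∀ {a} (f : H 1 (fun _ => a) b),
      motive (k := fun _ => 1) (q := fun _ _ => a) (fun _ => f))
    {k : Fin 1 → ℕ} {q : ∀ i, Fin (k i) → Ob} (φ : ∀ i, H (k i) (q i) b) : motive φ := by
  have aux : ∀ (k : Fin 1 → ℕ) (k₀ : ℕ) (_ : k = fun _ => k₀) (q : ∀ i, Fin (k i) → Ob)
      (x : Ob) (_ : q = fun _ _ => x) (_ : k₀ = 1) (φ : ∀ i, H (k i) (q i) b), motive φ := by
    rintro _ k₀ rfl _ x rfl rfl φ
    have hφ : (fun _ => φ 0) = φ := funext fun i => by rw [Subsingleton.elim i 0]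
    exact hφ ▸ h (φ 0)
  refine aux k (k 0) (funext fun i => congrArg k (Subsingleton.elim i 0)) q
    (q 0 ⟨0, by rw [hH (φ 0)]; exact Nat.one_pos⟩) ?_ (hH (φ 0)) φ
  funext i j
  obtain rfl := Subsingleton.elim i 0
  congr
  have := hH (φ 0)
  exact Fin.ext (by have := j.2; lia)

end UnaryRec

namespace Multicategory

/-- All morphisms are unary. -/
def IsUnary (P : Multicategory.{u}) : Prop := ∀ {n p a}, P.Hom n p a → n = 1

theorem unaryRec_comp {P : Multicategory.{u}} (hP : P.IsUnary)
    {motive : ∀ {n : ℕ} {p : Fin n → P.Ob} {a : P.Ob} {k : Fin n → ℕ} {q : ∀ i, Fin (k i) → P.Ob},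
      P.Hom n p a → (∀ i, P.Hom (k i) (q i) (p i)) → Prop}
    (h : ∀ {a b c : P.Ob} (g : P.Hom 1 (fun _ => b) c) (f : P.Hom 1 (fun _ => a) b),
      motive (k := fun _ => 1) (q := fun _ _ => a) g (fun _ => f))
    {n : ℕ} {p : Fin n → P.Ob} {a : P.Ob} {k : Fin n → ℕ} {q : ∀ i, Fin (k i) → P.Ob}
    (ψ : P.Hom n p a) (φ : ∀ i, P.Hom (k i) (q i) (p i)) : motive ψ φ := by
  revert k q φ
  refine unaryRec (H := P.Hom) hP (motive := fun {n p a} ψ =>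
    ∀ {k : Fin n → ℕ} {q : ∀ i, Fin (k i) → P.Ob} (φ : ∀ i, P.Hom (k i) (q i) (p i)), motive ψ φ)
    ?_ ψ
  intro b c g k q φ
  exact unaryFamilyRec (H := P.Hom) hP (motive := fun φ => motive g φ) (fun f => h g f) φ

end Multicategory

/-! ### Functors of unary operads -/

namespace MultiFunctor

variable {P Q : Multicategory.{u}}

theorem unary_injective (hP : P.IsUnary) {F G : MultiFunctor P Q} (h : F.unary = G.unary) :
    F = G := by
  obtain ⟨o, m, _, _⟩ := F
  obtain ⟨o', m', _, _⟩ := G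
  obtain rfl : o = o' := congrArg Functor.obj h
  congr
  funext n p a ψ
  refine unaryRec (H := P.Hom) hP (motive := fun ψ => m ψ = m' ψ) (fun {a b} f => ?_) ψ
  exact (Functor.congr_hom h (X := (show Multicategory.Unary P from a))
    (Y := (show Multicategory.Unary P from b)) f).trans
    ((Category.id_comp _).trans (Category.comp_id _))

/-- The functor of operads given by a functor of their underlying categories, if all morphisms of
the source are unary. -/
def ofUnary (hP : P.IsUnary) (F : P.Unary ⥤ Q.Unary) : MultiFunctor P Q where
  obj := F.obj
  map {n p a} ψ := unaryRec (H := P.Hom) hP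
    (motive := fun {n p a} _ => Q.Hom n (fun i => F.obj (p i)) (F.obj a)) (fun f => F.map f) ψ
  map_id a := F.map_id a
  map_comp ψ φ := by
    have key : ∀ {m n : ℕ} (_ : m = n) {a b : P.Ob} {x : P.Hom m (fun _ => a) b}
        {y : P.Hom n (fun _ => a) b} (_ : x ≍ y),
        unaryRec (H := P.Hom) hP
          (motive := fun {n p a} _ => Q.Hom n (fun i => F.obj (p i)) (F.obj a))
          (fun f => F.map f) x ≍ unaryRec (H := P.Hom) hP
          (motive := fun {n p a} _ => Q.Hom n (fun i => F.obj (p i)) (F.obj a))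
          (fun f => F.map f) y := by
      rintro m _ rfl a b x _ ⟨⟩
      rfl
    refine Multicategory.unaryRec_comp hP (motive := fun {n p a k q} ψ φ =>
      unaryRec (H := P.Hom) hP
        (motive := fun {n p a} _ => Q.Hom n (fun i => F.obj (p i)) (F.obj a))
        (fun f => F.map f) (P.comp ψ φ) =
      Q.comp (q := fun i j => F.obj (q i j)) (unaryRec (H := P.Hom) hP
        (motive := fun {n p a} _ => Q.Hom n (fun i => F.obj (p i)) (F.obj a))
        (fun f => F.map f) ψ) fun i => unaryRec (H := P.Hom) hP
        (motive := fun {n p a} _ => Q.Hom n (fun i => F.obj (p i)) (F.obj a))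
        (fun f => F.map f) (φ i)) (fun {a b c} g f => ?_) ψ φ
    refine eq_of_heq ((key (by simp) (P.unaryComp_heq g f).symm).trans ?_)
    exact (heq_of_eq (F.map_comp (X := a) (Y := b) (Z := c) f g)).trans (Q.unaryComp_heq _ _)

theorem isFullyFaithful_of_unary (hP : P.IsUnary) (hQ : Q.IsUnary) (F : MultiFunctor P Q)
    [F.unary.Full] [F.unary.Faithful] : F.IsFullyFaithful := by
  refine fun n p a => ⟨fun ψ => ?_, fun y => ?_⟩
  · refine unaryRec (H := P.Hom) hP (motive := fun ψ => ∀ ψ', F.map ψ = F.map ψ' → ψ = ψ')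
      (fun {a b} f f' h => ?_) ψ
    exact F.unary.map_injective (X := (show P.Unary from a)) (Y := (show P.Unary from b)) h
  · obtain rfl := hQ y
    obtain ⟨x, rfl⟩ : ∃ x, p = fun _ => x :=
      ⟨p 0, funext fun i => congrArg p (Subsingleton.elim i 0)⟩
    exact F.unary.map_surjective (X := (show P.Unary from x)) (Y := (show P.Unary from a)) y

theorem IsFullyFaithful.full_faithful {F : MultiFunctor P Q} (hF : F.IsFullyFaithful) :
    F.unary.Full ∧ F.unary.Faithful :=
  ⟨⟨fun {a b} => (hF 1 (fun _ => a) b).2⟩, ⟨fun {a b} _ _ h => (hF 1 (fun _ => a) b).1 h⟩⟩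

theorem essSurj_and_isFullyFaithful_iff (hP : P.IsUnary) (hQ : Q.IsUnary) (F : MultiFunctor P Q) :
    F.unary.EssSurj ∧ F.IsFullyFaithful ↔ F.unary.IsEquivalence := by
  refine ⟨fun ⟨_, h⟩ => ?_, fun _ => ⟨inferInstance, isFullyFaithful_of_unary hP hQ F⟩⟩
  obtain ⟨_, _⟩ := h.full_faithful
  exact { }

end MultiFunctor

/-! ### The operad of a category -/

section OfCat

/-- The hom-sets of a category, seen as an operad with unary morphisms only. -/
def UnaryHom (C : Type u) [Category.{u} C] : (n : ℕ) → (Fin n → C) → C → Type u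
  | 0, _, _ => PEmpty
  | 1, p, a => p 0 ⟶ a
  | _ + 2, _, _ => PEmpty

variable {C : Type u} [Category.{u} C]

theorem UnaryHom.arity {n : ℕ} {p : Fin n → C} {a : C} (x : UnaryHom C n p a) : n = 1 := by
  match n, p, x with
  | 1, _, _ => rfl

theorem UnaryHom.eq_pempty {n : ℕ} {p : Fin n → C} {a : C} (h : n ≠ 1) :
    UnaryHom C n p a = PEmpty.{u + 1} := by
  match n, p, h with
  | 0, _, _ => rfl
  | _ + 2, _, _ => rfl

theorem UnaryHom.congr_arity {m n : ℕ} (h : m = n) {a b : C} :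
    UnaryHom C m (fun _ => a) b = UnaryHom C n (fun _ => a) b := by
  rw [h]

/-- The composition of the operad of a category. -/
def UnaryHom.comp {n : ℕ} {p : Fin n → C} {a : C} {k : Fin n → ℕ} {q : ∀ i, Fin (k i) → C}
    (ψ : UnaryHom C n p a) :
    (∀ i, UnaryHom C (k i) (q i) (p i)) → UnaryHom C (∑ i, k i) (joinSeq q) a :=
  unaryRec (H := UnaryHom C) UnaryHom.arity (motive := fun {n p a} _ =>
    ∀ {k : Fin n → ℕ} {q : ∀ i, Fin (k i) → C}, (∀ i, UnaryHom C (k i) (q i) (p i)) →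
      UnaryHom C (∑ i, k i) (joinSeq q) a)
    (fun {_ c} g {_ _} φ => unaryFamilyRec (H := UnaryHom C) UnaryHom.arity
      (motive := fun {k q} _ => UnaryHom C (∑ i, k i) (joinSeq q) c)
      (fun {a} f => cast (α := UnaryHom C 1 (fun _ => a) c) (UnaryHom.congr_arity (by simp))
        (CategoryStruct.comp (X := a) (Z := c) f g)) φ) ψ

theorem UnaryHom.comp_heq {a b c : C} (g : b ⟶ c) (f : a ⟶ b) :
    UnaryHom.comp (n := 1) (p := fun _ => b) (k := fun _ => 1) (q := fun _ _ => a) g (fun _ => f) ≍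
      f ≫ g := by
  have h : UnaryHom.comp (n := 1) (p := fun _ => b) (k := fun _ => 1) (q := fun _ _ => a) g
      (fun _ => f) = cast (α := UnaryHom C 1 (fun _ => a) c) (UnaryHom.congr_arity (by simp))
        (f ≫ g : a ⟶ c) := rfl
  exact (heq_of_eq h).trans (cast_heq _ _)

theorem UnaryHom.comp_congr_left {a b c : C} {n : ℕ} (h : n = 1)
    {g : UnaryHom C n (fun _ => b) c} {g' : b ⟶ c} (hg : g ≍ g') (f : a ⟶ b) :
    UnaryHom.comp (k := fun _ => 1) (q := fun _ _ => a) g (fun _ => f) ≍ f ≫ g' := by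
  subst h; cases hg; exact UnaryHom.comp_heq _ _

theorem UnaryHom.comp_congr_right {a b c : C} {n : ℕ} (h : n = 1) (g : b ⟶ c)
    {f : UnaryHom C n (fun _ => a) b} {f' : a ⟶ b} (hf : f ≍ f') :
    UnaryHom.comp (n := 1) (p := fun _ => b) (k := fun _ => n) (q := fun _ _ => a) g (fun _ => f) ≍
      f' ≫ g := by
  subst h; cases hf; exact UnaryHom.comp_heq _ _

variable (C) in
/-- A category, seen as an operad with unary morphisms only. -/
def Multicategory.ofCat : Multicategory.{u} where
  Ob := C
  Hom := UnaryHom C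
  id a := 𝟙 a
  comp ψ φ := UnaryHom.comp ψ φ
  id_comp φ := unaryRec (H := UnaryHom C) UnaryHom.arity
    (motive := fun {n p a} φ => UnaryHom.comp (n := 1) (p := fun _ => a) (k := fun _ => n)
      (q := fun _ => p) (𝟙 a) (fun _ => φ) ≍ φ)
    (fun {a b} f => (UnaryHom.comp_heq (𝟙 b) f).trans
      (heq_of_eq (Category.comp_id (show a ⟶ b from f)))) φ
  comp_id ψ := unaryRec (H := UnaryHom C) UnaryHom.arity
    (motive := fun {n p a} ψ => UnaryHom.comp (k := fun _ => 1) (q := fun i _ => p i) ψ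
      (fun i => 𝟙 (p i)) ≍ ψ)
    (fun {a b} f => (UnaryHom.comp_heq f (𝟙 a)).trans
      (heq_of_eq (Category.id_comp (show a ⟶ b from f)))) ψ
  assoc {n p a k q l r} ψ φ χ := by
    obtain rfl := UnaryHom.arity ψ
    obtain ⟨b, rfl⟩ : ∃ b, p = fun _ => b :=
      ⟨p 0, funext fun i => congrArg p (Subsingleton.elim i 0)⟩
    revert l r χ
    refine unaryFamilyRec (H := UnaryHom C) UnaryHom.arity (motive := fun {k q} φ =>
      ∀ {l : ∀ i, Fin (k i) → ℕ} {r : ∀ i j, Fin (l i j) → C}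
      (χ : ∀ i j, UnaryHom C (l i j) (r i j) (q i j)),
      UnaryHom.comp (UnaryHom.comp ψ φ)
        (fun x => χ (finSigmaFinEquiv.symm x).1 (finSigmaFinEquiv.symm x).2) ≍
      UnaryHom.comp ψ (fun i => UnaryHom.comp (φ i) (χ i))) ?_ φ
    intro c f l r χ
    obtain ⟨l, rfl⟩ : ∃ l', l = fun _ => l' :=
      ⟨l 0, funext fun i => congrArg l (Subsingleton.elim i 0)⟩
    obtain ⟨r, rfl⟩ : ∃ r', r = fun _ => r' :=
      ⟨r 0, funext fun i => congrArg r (Subsingleton.elim i 0)⟩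
    obtain ⟨χ, rfl⟩ : ∃ χ', χ = fun _ => χ' :=
      ⟨χ 0, funext fun i => congrArg χ (Subsingleton.elim i 0)⟩
    refine unaryFamilyRec (H := UnaryHom C) UnaryHom.arity (b := c) (motive := fun {l r} χ =>
      UnaryHom.comp (k := fun x => l (finSigmaFinEquiv.symm x).2)
        (q := fun x => r (finSigmaFinEquiv.symm x).2)
        (UnaryHom.comp (p := fun _ => b) (k := fun _ => 1) (q := fun _ _ => c) ψ (fun _ => f))
        (fun x => χ (finSigmaFinEquiv.symm x).2) ≍
      UnaryHom.comp (p := fun _ => b) (k := fun _ => ∑ i, l i) (q := fun _ => joinSeq r) ψ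
        (fun _ => UnaryHom.comp (n := 1) (p := fun _ => c) f χ)) ?_ χ
    intro d e
    refine (UnaryHom.comp_congr_left (by simp) (UnaryHom.comp_heq ψ f) e).trans ?_
    refine HEq.trans ?_ (UnaryHom.comp_congr_right (by simp) ψ (UnaryHom.comp_heq f e)).symm
    exact heq_of_eq (Category.assoc _ _ _).symm

end OfCat

/-! ### Equality of categories and of operads -/

theorem CategoryTheory.Category.eq_of_heq_comp {C : Type u} {s t : Category.{u} C}
    (hHom : ∀ a b, s.Hom a b = t.Hom a b) (hid : ∀ a, s.id a ≍ t.id a)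
    (hcomp : ∀ {a b c} (f : s.Hom a b) (g : s.Hom b c) (f' : t.Hom a b) (g' : t.Hom b c),
      f ≍ f' → g ≍ g' → s.comp f g ≍ t.comp f' g') : s = t := by
  obtain @⟨@⟨⟨H⟩, i, c⟩, _, _, _⟩ := s
  obtain @⟨@⟨⟨H'⟩, i', c'⟩, _, _, _⟩ := t
  obtain rfl : H = H' := funext₂ hHom
  obtain rfl : i = i' := funext fun a => eq_of_heq (hid a)
  have h : ∀ {x y z} (f : H x y) (g : H y z), c f g = c' f g :=
    fun f g => eq_of_heq (hcomp f g f g HEq.rfl HEq.rfl)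
  obtain rfl : @c = @c' := by
    funext x y z f g
    exact h f g
  rfl

theorem Multicategory.eq_of_heq_comp {P Q : Multicategory.{u}} (hOb : P.Ob = Q.Ob)
    (hHom : ∀ n p a, P.Hom n p a = Q.Hom n (fun i => cast hOb (p i)) (cast hOb a))
    (hid : ∀ a, P.id a ≍ Q.id (cast hOb a))
    (hcomp : ∀ {n : ℕ} {p : Fin n → P.Ob} {a : P.Ob} {k : Fin n → ℕ} {q : ∀ i, Fin (k i) → P.Ob}
      (ψ : P.Hom n p a) (φ : ∀ i, P.Hom (k i) (q i) (p i))
      (ψ' : Q.Hom n (fun i => cast hOb (p i)) (cast hOb a))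
      (φ' : ∀ i, Q.Hom (k i) (fun j => cast hOb (q i j)) (cast hOb (p i))),
      ψ ≍ ψ' → (∀ i, φ i ≍ φ' i) →
        P.comp ψ φ ≍ Q.comp (q := fun i j => cast hOb (q i j)) ψ' φ') : P = Q := by
  obtain ⟨Ob, H, i, c, _, _, _⟩ := P
  obtain ⟨Ob', H', i', c', _, _, _⟩ := Q
  obtain rfl : Ob = Ob' := hOb
  obtain rfl : H = H' := funext fun n => funext₂ (hHom n)
  obtain rfl : i = i' := funext fun a => eq_of_heq (hid a)
  obtain rfl : @c = @c' := by
    funext n p a k q ψ φ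
    exact eq_of_heq (hcomp ψ φ ψ φ HEq.rfl fun _ => HEq.rfl)
  rfl

namespace Multicategory

theorem isUnary_ofCat (C : Type u) [Category.{u} C] : (ofCat C).IsUnary := UnaryHom.arity

theorem unary_ofCat (C : Cat.{u, u}) : Cat.of (ofCat C).Unary = C := by
  obtain ⟨C, s⟩ := C
  change Cat.of (ofCat C).Unary = Cat.of C
  have : (inferInstance : Category.{u} (ofCat C).Unary) = s := by
    refine Category.eq_of_heq_comp (fun _ _ => rfl) (fun _ => HEq.rfl) ?_
    rintro a b c f g _ _ ⟨⟩ ⟨⟩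
    exact ((ofCat C).unaryComp_heq _ _).trans (UnaryHom.comp_heq (C := C) g f)
  exact congrArg (fun s : Category.{u} C => @Cat.of C s) this

theorem ofCat_unary {P : Multicategory.{u}}
    (h : ∀ {n : ℕ} {p : Fin n → P.Ob} {a : P.Ob}, n ≠ 1 → P.Hom n p a = PEmpty.{u + 1}) :
    ofCat P.Unary = P := by
  refine eq_of_heq_comp rfl (fun n p a => ?_) (fun _ => HEq.rfl) ?_
  · by_cases hn : n = 1
    · subst hn
      change P.Hom 1 (fun _ => p 0) a = P.Hom 1 p a
      congr
      exact funext fun i => congrArg p (Subsingleton.elim 0 i)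
    · exact (UnaryHom.eq_pempty hn).trans (h hn).symm
  · intro n p a k q ψ φ
    refine unaryRec_comp (P := ofCat P.Unary) (isUnary_ofCat P.Unary)
      (motive := fun {n p a k q} ψ φ => ∀ (ψ' : P.Hom n p a) (φ' : ∀ i, P.Hom (k i) (q i) (p i)),
        ψ ≍ ψ' → (∀ i, φ i ≍ φ' i) → (ofCat P.Unary).comp ψ φ ≍ P.comp ψ' φ') ?_ ψ φ
    intro a b c g f g' φ' hg hφ
    obtain rfl := eq_of_heq hg
    obtain rfl : (fun _ => f) = φ' := funext fun i => eq_of_heq (hφ i)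
    exact (UnaryHom.comp_heq (C := P.Unary) g f).trans (P.unaryComp_heq g f)

/-! ### Symmetric structures on unary operads -/

theorem IsUnary.act_eq {P : Multicategory.{u}} (hP : P.IsUnary) {m n : ℕ} (σ : Fin m ≃ Fin n)
    {p : Fin n → P.Ob} {a : P.Ob} (ψ : P.Hom n p a) :
    P.Hom n p a = P.Hom m (fun i => p (σ i)) a := by
  obtain rfl : m = n := Fin.equiv_iff_eq.mp ⟨σ⟩
  obtain rfl := hP ψ
  obtain rfl : σ = Equiv.refl _ := Subsingleton.elim _ _
  rfl

/-- The unique symmetric structure of an operad whose morphisms are unary. -/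
def IsUnary.toSym {P : Multicategory.{u}} (hP : P.IsUnary) : SymMulticategory.{u} where
  toMulticategory := P
  act σ _ _ ψ := cast (hP.act_eq σ ψ) ψ
  act_refl _ := rfl
  act_trans τ σ _ _ ψ :=
    eq_of_heq ((cast_heq _ _).trans ((cast_heq _ _).trans (cast_heq _ _)).symm)
  act_comp {m n} σ _ _ _ _ ψ φ := by
    refine HEq.trans ?_ (cast_heq _ _).symm
    obtain rfl : m = n := Fin.equiv_iff_eq.mp ⟨σ⟩
    obtain rfl := hP ψ
    obtain rfl : σ = Equiv.refl _ := Subsingleton.elim _ _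
    rfl
  comp_act {n p a k' k q} τ ψ φ := by
    refine HEq.trans ?_ (cast_heq _ _).symm
    obtain rfl : k' = k := funext fun i => Fin.equiv_iff_eq.mp ⟨τ i⟩
    obtain rfl : τ = fun _ => Equiv.refl _ := funext fun i => Equiv.ext fun j => by
      have := hP (φ i)
      exact Fin.ext (by have := j.2; have := (τ i j).2; simp; lia)
    rfl

end Multicategory

namespace SymMulticategory

theorem act_heq {P : SymMulticategory.{u}} (hP : P.IsUnary) {m n : ℕ} (σ : Fin m ≃ Fin n)
    {p : Fin n → P.Ob} {a : P.Ob} (ψ : P.Hom n p a) : P.act σ ψ ≍ ψ := by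
  obtain rfl : m = n := Fin.equiv_iff_eq.mp ⟨σ⟩
  obtain rfl := hP ψ
  obtain rfl : σ = Equiv.refl _ := Subsingleton.elim _ _
  exact heq_of_eq (P.act_refl ψ)

theorem toMulticategory_injective {P Q : SymMulticategory.{u}} (hP : P.IsUnary)
    (h : P.toMulticategory = Q.toMulticategory) : P = Q := by
  have hP' := @act_heq P hP
  have hQ : Q.IsUnary := by
    rw [← h]
    exact hP
  have hQ' := @act_heq Q hQ
  obtain ⟨P, α, _, _, _, _⟩ := P
  obtain ⟨Q, β, _, _, _, _⟩ := Q
  obtain rfl : P = Q := h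
  obtain rfl : @α = @β := by
    funext m n σ p a ψ
    exact eq_of_heq ((hP' σ ψ).trans (hQ' σ ψ).symm)
  rfl

/-- A functor between unary symmetric operads is automatically symmetric. -/
theorem _root_.MultiFunctor.map_act_of_isUnary {P Q : SymMulticategory.{u}} (hP : P.IsUnary)
    (F : MultiFunctor P.toMulticategory Q.toMulticategory) {m n : ℕ}
    (σ : Fin m ≃ Fin n) {p : Fin n → P.Ob} {a : P.Ob} (ψ : P.Hom n p a) :
    F.map (P.act σ ψ) = Q.act σ (F.map ψ) := by
  obtain rfl : m = n := Fin.equiv_iff_eq.mp ⟨σ⟩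
  obtain rfl := hP ψ
  obtain rfl : σ = Equiv.refl _ := Subsingleton.elim _ _
  exact (congrArg F.map (P.act_refl ψ)).trans (Q.act_refl _).symm

end SymMulticategory

/-! ### Operads over `⋆` -/

theorem starMulticategory_hom_eq {n : ℕ} {p : Fin n → starMulticategory.{u}.Ob}
    {a : starMulticategory.{u}.Ob} (x y : starMulticategory.Hom n p a) : x = y :=
  eq_of_heq (StarHom.heq (m := n) (n := n) x y)

theorem SymMultiFunctor.toMultiFunctor_injective {P Q : SymMulticategory.{u}}
    {F G : SymMultiFunctor P Q} (h : F.toMultiFunctor = G.toMultiFunctor) : F = G := by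
  obtain ⟨F, _⟩ := F
  obtain ⟨G, _⟩ := G
  obtain rfl : F = G := h
  rfl

theorem CategoryTheory.Over.eq_of_left_eq {C : Type*} [Category C] {S : C}
    (hS : ∀ X : C, Subsingleton (X ⟶ S)) {X Y : Over S} (h : X.left = Y.left) : X = Y := by
  obtain ⟨X, ⟨⟨⟩⟩, f⟩ := X
  obtain ⟨Y, ⟨⟨⟩⟩, g⟩ := Y
  obtain rfl : X = Y := h
  obtain rfl : f = g := (hS X).elim f g
  rfl

namespace Ope

theorem subsingleton_hom_star (P : Ope.{u}) : Subsingleton (P ⟶ star.{u}) where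
  allEq := by
    rintro ⟨o, m, _, _⟩ ⟨o', m', _, _⟩
    obtain rfl : o = o' := funext fun _ => rfl
    congr
    funext n p a ψ
    exact starMulticategory_hom_eq _ _

theorem isUnary_left (X : Over star.{u}) : X.left.IsUnary := fun ψ =>
  StarHom.arity (MultiFunctor.map X.hom ψ)

theorem hom_left_eq_pempty (X : Over star.{u}) {n : ℕ} {p : Fin n → X.left.Ob} {a : X.left.Ob}
    (h : n ≠ 1) : X.left.Hom n p a = PEmpty.{u + 1} :=
  X.left.eq_pempty h ⟨fun ψ => h (isUnary_left X ψ)⟩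

/-- The unique functor of a unary operad to `⋆`. -/
def _root_.Multicategory.IsUnary.toStar {P : Multicategory.{u}} (hP : P.IsUnary) :
    MultiFunctor P starMulticategory.{u} where
  obj _ := PUnit.unit
  map ψ := StarHom.mk (hP ψ)
  map_id _ := rfl
  map_comp _ _ := rfl

/-- A category as an operad over `⋆`. -/
def overOfCat (C : Type u) [Category.{u} C] : Over star.{u} :=
  Over.mk (Y := ⟨Multicategory.ofCat C, fun h _ => UnaryHom.eq_pempty h⟩)
    (Multicategory.IsUnary.toStar (Multicategory.isUnary_ofCat C))

instance : sliceToCat.{u}.Faithful where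
  map_injective {X _ _ _} h :=
    Over.OverMorphism.ext (MultiFunctor.unary_injective (isUnary_left X)
      (congrArg Cat.Hom.toFunctor h))

instance : sliceToCat.{u}.Full where
  map_surjective {X Y} F :=
    ⟨Over.homMk (MultiFunctor.ofUnary (P := X.left.toMulticategory)
      (Q := Y.left.toMulticategory) (isUnary_left X) F.toFunctor)
      ((subsingleton_hom_star _).elim _ _), rfl⟩

theorem overOfCat_sliceToCat (X : Over star.{u}) : overOfCat (sliceToCat.obj X) = X := by
  refine Over.eq_of_left_eq subsingleton_hom_star ?_
  have h := Multicategory.ofCat_unary (hom_left_eq_pempty X)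
  obtain ⟨⟨P, hP⟩, ⟨⟨⟩⟩, F⟩ := X
  change Ope.mk _ _ = Ope.mk _ _
  congr

theorem sliceToCat_bijective : Function.Bijective sliceToCat.{u}.obj :=
  ⟨Function.LeftInverse.injective (g := fun C : Cat.{u, u} => overOfCat C) overOfCat_sliceToCat,
    fun C => ⟨overOfCat C, Multicategory.unary_ofCat C⟩⟩

theorem slice_eq_inverseImage :
    folkOpe.{u}.slice star.{u} = folkCat.{u}.inverseImage sliceToCat := by
  refine ModelClasses.ext ?_ rfl rfl
  funext X Y F
  exact propext (MultiFunctor.essSurj_and_isFullyFaithful_iff (isUnary_left X) (isUnary_left Y) _)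

end Ope

namespace OpeSigma

theorem subsingleton_hom_star (P : OpeSigma.{u}) : Subsingleton (P ⟶ star.{u}) where
  allEq F G := SymMultiFunctor.toMultiFunctor_injective
    ((Ope.subsingleton_hom_star (forget.obj P)).elim (forget.map F) (forget.map G))

/-- The functor forgetting the symmetric group actions, over `⋆`. -/
def overForget : Over star.{u} ⥤ Over Ope.star.{u} := Over.post forget.{u}

theorem isUnary_left (X : Over star.{u}) : X.left.IsUnary :=
  Ope.isUnary_left (overForget.obj X)

instance : overForget.{u}.Faithful where
  map_injective {X _ F G} h := by
    exact Over.OverMorphism.ext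
      (SymMultiFunctor.toMultiFunctor_injective (congrArg CommaMorphism.left h))

instance : overForget.{u}.Full where
  map_surjective {X _} F :=
    ⟨Over.homMk ⟨F.left, MultiFunctor.map_act_of_isUnary (isUnary_left X) F.left⟩
      ((subsingleton_hom_star _).elim _ _), rfl⟩

theorem overForget_bijective : Function.Bijective overForget.{u}.obj := by
  refine ⟨fun X Y h => Over.eq_of_left_eq subsingleton_hom_star ?_, fun X => ?_⟩
  · have h' := SymMulticategory.toMulticategory_injective (isUnary_left X)
      (congrArg (fun Z => Z.left.toMulticategory) h)
    obtain ⟨⟨P, _⟩, ⟨⟨⟩⟩, F⟩ := X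
    obtain ⟨⟨Q, _⟩, ⟨⟨⟩⟩, G⟩ := Y
    obtain rfl : P = Q := h'
    rfl
  · refine ⟨Over.mk (Y := ⟨Multicategory.IsUnary.toSym (Ope.isUnary_left X), X.left.eq_pempty⟩)
      ⟨X.hom, fun _ _ _ _ => starMulticategory_hom_eq _ _⟩, ?_⟩
    exact Over.eq_of_left_eq Ope.subsingleton_hom_star rfl

theorem slice_eq_inverseImage :
    folkOpeSigma.{u}.slice star.{u} = folkCat.{u}.inverseImage sliceToCat :=
  congrArg (fun M => M.inverseImage overForget.{u}) Ope.slice_eq_inverseImage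

instance : sliceToCat.{u}.Full := inferInstanceAs (overForget ⋙ Ope.sliceToCat).Full

instance : sliceToCat.{u}.Faithful := inferInstanceAs (overForget ⋙ Ope.sliceToCat).Faithful

theorem sliceToCat_bijective : Function.Bijective sliceToCat.{u}.obj :=
  Ope.sliceToCat_bijective.comp overForget_bijective

end OpeSigma

theorem mainTheorem4 :
    -- the folk classes form a model structure on the category of small categories
    folkCat.{u}.IsModelStructure.{u} ∧
    -- non-symmetric operads: `(P → ⋆) ↦ j^* P` is an isomorphism of categories, the slice classes
    -- form a model structure, and they correspond to the folk classes under the isomorphism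
    (∃ G : Cat.{u, u} ⥤ Over Ope.star.{u},
      Ope.sliceToCat.{u} ⋙ G = 𝟭 (Over Ope.star.{u}) ∧
      G ⋙ Ope.sliceToCat.{u} = 𝟭 Cat.{u, u} ∧
      (folkOpe.{u}.slice Ope.star.{u}).IsModelStructure.{u} ∧
      folkOpe.{u}.slice Ope.star.{u} = folkCat.{u}.inverseImage Ope.sliceToCat.{u} ∧
      (folkOpe.{u}.slice Ope.star.{u}).inverseImage G = folkCat.{u}) ∧
    -- symmetric operads
    (∃ G : Cat.{u, u} ⥤ Over OpeSigma.star.{u},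
      OpeSigma.sliceToCat.{u} ⋙ G = 𝟭 (Over OpeSigma.star.{u}) ∧
      G ⋙ OpeSigma.sliceToCat.{u} = 𝟭 Cat.{u, u} ∧
      (folkOpeSigma.{u}.slice OpeSigma.star.{u}).IsModelStructure.{u} ∧
      folkOpeSigma.{u}.slice OpeSigma.star.{u} =
        folkCat.{u}.inverseImage OpeSigma.sliceToCat.{u} ∧
      (folkOpeSigma.{u}.slice OpeSigma.star.{u}).inverseImage G = folkCat.{u}) :=
  ⟨folkCat_isModelStructure,
    ModelClasses.exists_strict_inverse_and_isModelStructure folkCat_isModelStructure _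
      Ope.sliceToCat_bijective Ope.slice_eq_inverseImage,
    ModelClasses.exists_strict_inverse_and_isModelStructure folkCat_isModelStructure _
      OpeSigma.sliceToCat_bijective OpeSigma.slice_eq_inverseImage⟩
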